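/- Proposition 5.1. For $a=(a_1,\dots,a_4),\,b=(b_1,\dots,b_4)\in\mathbb R^4$ and $c=(c_1,\dots,c_4)\in\mathbb C^4$ let $X(a,b,c)$ be the self-adjoint $8\times 8$ matrix on $\mathbb C^2\otimes\mathbb C^2\otimes\mathbb C^2$ (product basis in lexicographic order) with diagonal $(a_1,a_2,a_3,a_4,b_4,b_3,b_2,b_1)$, with anti-diagonal, read from the top right to the bottom left corner, $(c_1,c_2,c_3,c_4,\bar c_4,\bar c_3,\bar c_2,\bar c_1)$, and with all other entries $0$. A three qubit state is called separable if it is a convex combination of pure product states $|x\rangle\langle x|\otimes|y\rangle\langle y|\otimes|z\rangle\langle z|$ with unit vectors $x,y,z\in\mathbb C^2$; an unnormalized state is called separable if it is a nonnegative multiple of such a convex combination. Let $a,b\in\mathbb R^4$, $r_1,r_2,r_3,r_4\ge 0$ and $\varphi\in\mathbb R$, and put $$c=(r_1e^{i\varphi},\,r_2,\,r_3,\,r_4),\qquad c'=\Bigl(\tfrac{r_1+r_4}{2}e^{i\varphi},\,\tfrac{r_2+r_3}{2},\,\tfrac{r_2+r_3}{2},\,\tfrac{r_1+r_4}{2}\Bigr).$$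 If $X(a,b,c)$ is separable, then $X(a,b,c')$ is separable. This holds both for normalized states and for unnormalized states. -/

import Mathlib

open scoped Kronecker

noncomputable section

namespace ThreeQubit

/-- The index set of the standard product basis `|i j k⟩` of `ℂ² ⊗ ℂ² ⊗ ℂ²`. -/
abbrev Idx : Type := Fin 2 × Fin 2 × Fin 2

/-- The (zero based) position of `|i j k⟩` in the lexicographic order `000, 001, …, 111`. -/
def lexIndex (p : Idx) : Fin 8 :=
  ⟨4 * p.1.val + 2 * p.2.1.val + p.2.2.val, by omega⟩

/-- The three qubit self-adjoint X-shaped matrix `X(a,b,c)` with diagonal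
`a₁, a₂, a₃, a₄, b₄, b₃, b₂, b₁` and anti-diagonal (from the top right corner)
`c₁, c₂, c₃, c₄, conj c₄, conj c₃, conj c₂, conj c₁`,
with respect to the lexicographic order of indices. -/
def xMatrix (a b : Fin 4 → ℝ) (c : Fin 4 → ℂ) : Matrix Idx Idx ℂ :=
  Matrix.submatrix
    !![(a 0 : ℂ), 0, 0, 0, 0, 0, 0, c 0;
       0, (a 1 : ℂ), 0, 0, 0, 0, c 1, 0;
       0, 0, (a 2 : ℂ), 0, 0, c 2, 0, 0;
       0, 0, 0, (a 3 : ℂ), c 3, 0, 0, 0;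
       0, 0, 0, star (c 3), (b 3 : ℂ), 0, 0, 0;
       0, 0, star (c 2), 0, 0, (b 2 : ℂ), 0, 0;
       0, star (c 1), 0, 0, 0, 0, (b 1 : ℂ), 0;
       star (c 0), 0, 0, 0, 0, 0, 0, (b 0 : ℂ)]
    lexIndex lexIndex

/-- A unit vector of the one qubit space `ℂ²`. -/
def IsUnitVec (x : Fin 2 → ℂ) : Prop :=
  ∑ i, ‖x i‖ ^ 2 = 1

/-- The rank one matrix `|x⟩⟨x|`. -/
def ketBra (x : Fin 2 → ℂ) : Matrix (Fin 2) (Fin 2) ℂ :=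
  Matrix.vecMulVec x (star x)

/-- The pure product states `|x⟩⟨x| ⊗ |y⟩⟨y| ⊗ |z⟩⟨z|`, with `x, y, z` unit vectors. -/
def pureProductStates : Set (Matrix Idx Idx ℂ) :=
  {ρ | ∃ x y z : Fin 2 → ℂ, IsUnitVec x ∧ IsUnitVec y ∧ IsUnitVec z ∧
    ρ = ketBra x ⊗ₖ (ketBra y ⊗ₖ ketBra z)}

/-- A (normalized) three qubit state is (fully) separable if it is a convex combination of
pure product states. -/
def IsSeparable (ρ : Matrix Idx Idx ℂ) : Prop :=
  ρ ∈ convexHull ℝ pureProductStates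

/-- An unnormalized state is separable if it is a nonnegative multiple of a separable
normalized state. -/
def IsUnnormalizedSeparable (ρ : Matrix Idx Idx ℂ) : Prop :=
  ∃ (t : ℝ) (σ : Matrix Idx Idx ℂ), 0 ≤ t ∧ IsSeparable σ ∧ ρ = t • σ

end ThreeQubit

end

open scoped ComplexConjugate

namespace ThreeQubit

/-! Transposing two of the qubits and then applying local phase gates is a linear map preserving
separability. On X-shaped matrices it fixes the diagonal and, for a suitable phase, sends `c` to
`(r₄e^{iφ}, r₃, r₂, r₁)`. The midpoint of the matrix and its image is `X(a,b,c')`, so convexity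
concludes; by linearity a nonnegative scalar factor passes through. -/

/-- The diagonal qubit phase gate with diagonal `(w, 1)`. -/
def phase (w : ℂ) : Fin 2 → ℂ := ![w, 1]

/-- Partial transposition on the second and third qubit, followed by conjugation with the
phase gate `diag (w, 1)` on each of these two qubits. -/
def twist (w : ℂ) : Matrix Idx Idx ℂ →ₗ[ℝ] Matrix Idx Idx ℂ where
  toFun M := Matrix.of fun p q =>
    phase w p.2.1 * phase w p.2.2 * conj (phase w q.2.1 * phase w q.2.2) *
      M (p.1, q.2) (q.1, p.2)
  map_add' M N := by
    ext p q
    simp [mul_add]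
  map_smul' r M := by
    ext p q
    simp only [Matrix.of_apply, Matrix.smul_apply, RingHom.id_apply, Complex.real_smul]
    ring

theorem norm_phase {w : ℂ} (hw : ‖w‖ = 1) (i : Fin 2) : ‖phase w i‖ = 1 := by
  fin_cases i <;> simp [phase, hw]

theorem IsUnitVec.phase_mul_conj {w : ℂ} (hw : ‖w‖ = 1) {x : Fin 2 → ℂ} (hx : IsUnitVec x) :
    IsUnitVec fun i => phase w i * conj (x i) := by
  simpa [IsUnitVec, norm_phase hw] using hx

/-- The transpose of `|y⟩⟨y|` is `|ȳ⟩⟨ȳ|`, so a product vector `x ⊗ y ⊗ z` becomes `x ⊗ Dȳ ⊗ Dz̄`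
with `D = diag (w, 1)` unitary. -/
theorem twist_mem_pureProductStates {w : ℂ} (hw : ‖w‖ = 1) {ρ : Matrix Idx Idx ℂ}
    (hρ : ρ ∈ pureProductStates) : twist w ρ ∈ pureProductStates := by
  obtain ⟨x, y, z, hx, hy, hz, rfl⟩ := hρ
  refine ⟨x, _, _, hx, hy.phase_mul_conj hw, hz.phase_mul_conj hw, ?_⟩
  ext p q
  simp only [twist, LinearMap.coe_mk, AddHom.coe_mk, Matrix.of_apply, Matrix.kroneckerMap_apply,
    ketBra, Matrix.vecMulVec_apply, Pi.star_apply, star_mul', RCLike.star_def, map_mul,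
    Complex.conj_conj]
  ring

theorem IsSeparable.twist {w : ℂ} (hw : ‖w‖ = 1) {ρ : Matrix Idx Idx ℂ} (hρ : IsSeparable ρ) :
    IsSeparable (twist w ρ) := by
  have h : ThreeQubit.twist w ρ ∈ ThreeQubit.twist w '' convexHull ℝ pureProductStates :=
    Set.mem_image_of_mem _ hρ
  rw [LinearMap.image_convexHull] at h
  refine convexHull_mono ?_ h
  rintro _ ⟨σ, hσ, rfl⟩
  exact twist_mem_pureProductStates hw hσ

theorem IsSeparable.midpoint {ρ σ : Matrix Idx Idx ℂ} (hρ : IsSeparable ρ) (hσ : IsSeparable σ) :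
    IsSeparable ((1 / 2 : ℝ) • ρ + (1 / 2 : ℝ) • σ) :=
  convex_convexHull ℝ _ hρ hσ (by norm_num) (by norm_num) (by norm_num)

/-- Partial transposition exchanges the anti-diagonal positions `(000,111)` with `(011,100)` and
`(001,110)` with `(010,101)`. The phases of the two gates add up on the first pair and cancel on the
second. -/
theorem twist_xMatrix {w : ℂ} (hw : ‖w‖ = 1) (a b : Fin 4 → ℝ) (c : Fin 4 → ℂ) :
    twist w (xMatrix a b c) =
      xMatrix a b ![w ^ 2 * c 3, c 2, c 1, conj w ^ 2 * c 0] := by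
  have h : w * conj w = 1 := by simp [Complex.mul_conj', hw]
  have h₂ : w * w * (conj w * conj w) = 1 := by linear_combination (w * conj w + 1) * h
  ext ⟨i, j, k⟩ ⟨i', j', k'⟩
  fin_cases i <;> fin_cases j <;> fin_cases k <;> fin_cases i' <;> fin_cases j' <;>
    fin_cases k' <;> simp [twist, phase, xMatrix, lexIndex, h, h₂, sq]

theorem half_smul_xMatrix_add (a b : Fin 4 → ℝ) (c d : Fin 4 → ℂ) :
    (1 / 2 : ℝ) • xMatrix a b c + (1 / 2 : ℝ) • xMatrix a b d =
      xMatrix a b fun i => (c i + d i) / 2 := by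
  ext ⟨i, j, k⟩ ⟨i', j', k'⟩
  fin_cases i <;> fin_cases j <;> fin_cases k <;> fin_cases i' <;> fin_cases j' <;>
    fin_cases k' <;> simp [xMatrix, lexIndex] <;> ring

end ThreeQubit

theorem proposition5p1 (a b : Fin 4 → ℝ) (r₁ r₂ r₃ r₄ φ : ℝ)
    (hr₁ : 0 ≤ r₁) (hr₂ : 0 ≤ r₂) (hr₃ : 0 ≤ r₃) (hr₄ : 0 ≤ r₄)
    (c c' : Fin 4 → ℂ)
    (hc : c = ![(r₁ : ℂ) * Complex.exp (Complex.I * (φ : ℂ)), (r₂ : ℂ), (r₃ : ℂ), (r₄ : ℂ)])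
    (hc' : c' = ![(((r₁ + r₄) / 2 : ℝ) : ℂ) * Complex.exp (Complex.I * (φ : ℂ)),
      (((r₂ + r₃) / 2 : ℝ) : ℂ), (((r₂ + r₃) / 2 : ℝ) : ℂ), (((r₁ + r₄) / 2 : ℝ) : ℂ)]) :
    (ThreeQubit.IsSeparable (ThreeQubit.xMatrix a b c) →
      ThreeQubit.IsSeparable (ThreeQubit.xMatrix a b c')) ∧
    (ThreeQubit.IsUnnormalizedSeparable (ThreeQubit.xMatrix a b c) →
      ThreeQubit.IsUnnormalizedSeparable (ThreeQubit.xMatrix a b c')) := by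
  -- Half the angle, since the corner entry picks up one factor `w` from each of the two gates.
  set w : ℂ := Complex.exp ((φ / 2 : ℝ) * Complex.I) with hwdef
  have hw : ‖w‖ = 1 := Complex.norm_exp_ofReal_mul_I _
  have hsq : w ^ 2 = Complex.exp (Complex.I * φ) := by
    rw [hwdef, ← Complex.exp_nat_mul]
    congr 1
    push_cast
    ring
  have hconj : (starRingEnd ℂ) w ^ 2 * Complex.exp (Complex.I * φ) = 1 := by
    rw [← hsq, ← mul_pow, Complex.conj_mul', hw]
    simp
  have key : ThreeQubit.xMatrix a b c' = (1 / 2 : ℝ) • ThreeQubit.xMatrix a b c +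
      (1 / 2 : ℝ) • ThreeQubit.twist w (ThreeQubit.xMatrix a b c) := by
    rw [ThreeQubit.twist_xMatrix hw, ThreeQubit.half_smul_xMatrix_add, hc', hc, ← hsq]
    rw [← hsq] at hconj
    congr 1
    ext i
    fin_cases i
    · simp
      ring
    · simp
    · simp [add_comm]
    · simp
      linear_combination -(r₁ : ℂ) * hconj
  constructor
  · intro h
    rw [key]
    exact h.midpoint (h.twist hw)
  · rintro ⟨t, σ, ht, hσ, h⟩
    refine ⟨t, _, ht, hσ.midpoint (hσ.twist hw), ?_⟩
    rw [key, h, map_smul, smul_add, smul_comm t, smul_comm t]
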